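/- Let $k\ge 2$ and $n\ge 2^k$, and let $C$ be a cycle on $2^k$ vertices contained as a subgraph in the complete graph $K_n$. Let $G$ be the unweighted graph on the $n$ vertices of $K_n$ obtained by removing all edges of $C$ from $K_n$. Let $M$ be any one of the adjacency matrix $A$, the Laplacian matrix $L=\Delta-A$, or the signless Laplacian matrix $Q=\Delta+A$ of $G$, where $\Delta$ is the diagonal matrix of vertex degrees, and put $U(t)=\exp(\mathrm{i}tM)$ for $t\in\mathbb{R}$. Let $\{a,c\}$ and $\{b,d\}$ be pairs of antipodal vertices of $C$ (i.e., vertices whose distance in $C$ equals the diameter of $C$), with $a\neq b$. Then $G$ has pretty good state transfer relative to $M$ between the unit vectors $\frac{1}{\sqrt2}(\mathbf e_a-\mathbf e_b)$ and $\frac{1}{\sqrt2}(\mathbf e_c-\mathbf e_d)$; that is, there exist a sequence $(t_j)$ of real numbers and $\gamma\in\mathbb{C}$ with $|\gamma|=1$ such that $$\lim_{j\to\infty}U(t_j)\,\tfrac{1}{\sqrt2}(\mathbf e_a-\mathbf e_b)=\gamma\,\tfrac{1}{\sqrt2}(\mathbf e_c-\mathbf e_d).$$ -/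

import Mathlib

/-- The three standard Hamiltonians of a continuous-time quantum walk on a graph. -/
inductive HamiltonianType
  | adjacency
  | laplacian
  | signlessLaplacian

/-- The matrix `M(G)` of an unweighted graph: `A`, `L = Δ - A` or `Q = Δ + A`. -/
noncomputable def hamiltonian {V : Type*} [Fintype V] [DecidableEq V]
    (m : HamiltonianType) (G : SimpleGraph V) : Matrix V V ℝ :=
  open Classical in
  match m with
  | .adjacency => G.adjMatrix ℝ
  | .laplacian => G.degMatrix ℝ - G.adjMatrix ℝ
  | .signlessLaplacian => G.degMatrix ℝ + G.adjMatrix ℝ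

/-- The transition matrix `U(t) = exp(i t M)`. -/
noncomputable def transitionMatrix {V : Type*} [Fintype V] [DecidableEq V]
    (M : Matrix V V ℝ) (t : ℝ) : Matrix V V ℂ :=
  NormedSpace.exp ((Complex.I * (t : ℂ)) • M.map (fun r : ℝ => (r : ℂ)))

/-- A real pure state is given by a real vector of Euclidean norm one. -/
def IsRealPureState {V : Type*} [Fintype V] (x : V → ℝ) : Prop :=
  ∑ v, x v ^ 2 = 1

/-- Pretty good state transfer between the real pure states `x` and `y` relative to `M`:
`U(t_k) x → γ y` for some real sequence `t_k` and some phase factor `γ`. -/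
def PrettyGoodStateTransfer {V : Type*} [Fintype V] [DecidableEq V]
    (M : Matrix V V ℝ) (x y : V → ℝ) : Prop :=
  IsRealPureState x ∧ IsRealPureState y ∧
    ∃ (t : ℕ → ℝ) (γ : ℂ), ‖γ‖ = 1 ∧
      Filter.Tendsto
        (fun k => (transitionMatrix M (t k)).mulVec (fun v => (x v : ℂ)))
        Filter.atTop (nhds (γ • fun v => (y v : ℂ)))

/-- The vector `(e_a - e_b) / √2`. -/
noncomputable def pairState {V : Type*} [DecidableEq V] (a b : V) : V → ℝ :=
  (1 / Real.sqrt 2) • (Pi.single a 1 - Pi.single b 1)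

/-- Two vertices are antipodal if their distance is the diameter of the graph. -/
def IsAntipodal {V : Type*} (G : SimpleGraph V) (u v : V) : Prop :=
  G.dist u v = G.diam

/-- The graph obtained from `K_n` by removing all edges of a copy of the cycle `C_N` in it. -/
def completeMinusCycle {N n : ℕ}
    (φ : SimpleGraph.Copy (SimpleGraph.cycleGraph N) (⊤ : SimpleGraph (Fin n))) :
    SimpleGraph (Fin n) :=
  (⊤ : SimpleGraph (Fin n)).deleteEdges φ.toSubgraph.edgeSet

/-!
On sum-zero vectors supported on the cycle `C` of length `N = 2 ^ k`, each of the three Hamiltonians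
acts as `α ± A(C)`, so its eigenvectors there are the nontrivial characters of `ℤ/N`, with
eigenvalues `α ± 2 Re z` where `z` is the value of the character at `1`. The numbers
`2 cos (2πr / N)`, `0 ≤ r < N / 4`, are linearly independent over `ℤ` because the cyclotomic
polynomial has degree `N / 2`, so Kronecker's theorem gives times at which
`exp (i t 2 Re z) → ± z ^ (N / 2)` simultaneously for all `N`-th roots of unity `z`. Hence, up to a
phase, `U(t)` tends to the translation by `N / 2`, which is the antipodal map of the cycle.
-/

open Filter Topology
open scoped Matrix

section Kronecker

open MeasureTheory

theorem tendsto_mean_exp_mul_I (μ : ℝ) :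
    Tendsto (fun T : ℝ => T⁻¹ • ∫ t in (0 : ℝ)..T, Complex.exp (Complex.I * μ * t))
      atTop (𝓝 (if μ = 0 then 1 else 0)) := by
  split_ifs with h
  · subst h
    refine tendsto_const_nhds.congr' ?_
    filter_upwards [eventually_gt_atTop 0] with T hT
    simp [hT.ne']
  · have hT : Tendsto (fun T : ℝ => T⁻¹ * (2 / |μ|)) atTop (𝓝 0) := by
      simpa only [zero_mul] using tendsto_inv_atTop_zero.mul_const (2 / |μ|)
    refine squeeze_zero_norm' ?_ hT
    filter_upwards [eventually_gt_atTop 0] with T hT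
    have hnorm (s : ℝ) : ‖Complex.exp (Complex.I * μ * s)‖ = 1 := by
      simp [Complex.norm_exp]
    rw [integral_exp_mul_complex (by simp [h]), norm_smul, norm_div, norm_mul, norm_inv,
      Complex.norm_real, Complex.norm_I, one_mul, Real.norm_eq_abs, Real.norm_eq_abs,
      abs_of_pos hT]
    gcongr
    linarith [norm_sub_le (Complex.exp (Complex.I * μ * T)) (Complex.exp (Complex.I * μ * (0 : ℝ))),
      hnorm T, hnorm 0]

variable {ι : Type*} {θ : ι → ℝ}

/-- The linear flow on the torus `(ℝ / ℤ)^ι` with frequencies `θ`, started at `0`. -/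
def torusFlow (θ : ι → ℝ) (t : ℝ) : UnitAddTorus ι :=
  fun i => ((t * θ i : ℝ) : UnitAddCircle)

theorem continuous_torusFlow (θ : ι → ℝ) : Continuous (torusFlow θ) :=
  continuous_pi fun _ =>
    (AddCircle.continuous_mk' 1).comp (continuous_id.mul continuous_const)

/-- The mean over the time interval `[0, T]` of the observable `f` along the flow. -/
noncomputable def torusFlowMean (θ : ι → ℝ) (T : ℝ) (f : C(UnitAddTorus ι, ℂ)) : ℂ :=
  T⁻¹ • ∫ t in (0 : ℝ)..T, f (torusFlow θ t)

theorem intervalIntegrable_torusFlow (θ : ι → ℝ) (f : C(UnitAddTorus ι, ℂ)) (a b : ℝ) :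
    IntervalIntegrable (fun t => f (torusFlow θ t)) volume a b :=
  (f.continuous.comp (continuous_torusFlow θ)).intervalIntegrable a b

theorem torusFlowMean_add (T : ℝ) (f g : C(UnitAddTorus ι, ℂ)) :
    torusFlowMean θ T (f + g) = torusFlowMean θ T f + torusFlowMean θ T g := by
  simp only [torusFlowMean, ContinuousMap.add_apply, ← smul_add,
    intervalIntegral.integral_add (intervalIntegrable_torusFlow θ f 0 T)
      (intervalIntegrable_torusFlow θ g 0 T)]

theorem torusFlowMean_smul (T : ℝ) (c : ℂ) (f : C(UnitAddTorus ι, ℂ)) :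
    torusFlowMean θ T (c • f) = c • torusFlowMean θ T f := by
  simp only [torusFlowMean, ContinuousMap.smul_apply, intervalIntegral.integral_smul,
    smul_comm _ c]

theorem norm_torusFlowMean_le (θ : ι → ℝ) (T : ℝ) (f : C(UnitAddTorus ι, ℂ)) :
    ‖torusFlowMean θ T f‖ ≤ ‖f‖ := by
  have hint := intervalIntegral.norm_integral_le_of_norm_le_const (a := 0) (b := T)
    fun t _ => f.norm_coe_le_norm (torusFlow θ t)
  rw [sub_zero, ← Real.norm_eq_abs] at hint
  calc ‖torusFlowMean θ T f‖ ≤ ‖T‖⁻¹ * (‖f‖ * ‖T‖) := by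
        rw [torusFlowMean, norm_smul, norm_inv]; gcongr
    _ = ‖f‖ * (‖T‖⁻¹ * ‖T‖) := by ring
    _ ≤ ‖f‖ := mul_le_of_le_one_right (norm_nonneg f) (inv_mul_le_one)

theorem equicontinuous_torusFlowMean (θ : ι → ℝ) :
    Equicontinuous fun T f => torusFlowMean θ T f := by
  refine (LipschitzWith.uniformEquicontinuous _ 1 fun T =>
    LipschitzWith.of_dist_le_mul fun f g => ?_).equicontinuous
  have hsub : torusFlowMean θ T (f - g) = torusFlowMean θ T f - torusFlowMean θ T g := by
    rw [eq_sub_iff_add_eq, ← torusFlowMean_add, sub_add_cancel]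
  simpa only [dist_eq_norm, NNReal.coe_one, one_mul, hsub] using norm_torusFlowMean_le θ T (f - g)

section Fintype

variable [Fintype ι]

theorem mFourier_torusFlow (n : ι → ℤ) (θ : ι → ℝ) (t : ℝ) :
    UnitAddTorus.mFourier n (torusFlow θ t) =
      Complex.exp (Complex.I * (2 * Real.pi * ∑ i, n i • θ i : ℝ) * t) := by
  simp only [UnitAddTorus.mFourier, ContinuousMap.coe_mk, torusFlow, fourier_coe_apply,
    ← Complex.exp_sum]
  push_cast
  simp only [Finset.mul_sum, Finset.sum_mul, zsmul_eq_mul]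
  exact congrArg _ (Finset.sum_congr rfl fun i _ => by ring)

theorem integral_fourier (n : ℤ) :
    ∫ x : UnitAddCircle, fourier n x = if n = 0 then 1 else 0 := by
  split_ifs with h
  · simp [h, Measure.real]
  · exact integral_eq_zero_of_add_right_eq_neg (fourier_add_half_inv_index h one_pos)

theorem integral_mFourier (n : ι → ℤ) :
    ∫ x, UnitAddTorus.mFourier n x = if n = 0 then 1 else 0 := by
  simp only [UnitAddTorus.mFourier, ContinuousMap.coe_mk]
  rw [integral_fintype_prod_volume_eq_prod fun i (x : UnitAddCircle) => fourier (n i) x]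
  simp only [integral_fourier, Finset.prod_ite_zero, Finset.mem_univ, true_imp_iff,
    Finset.prod_const_one, funext_iff, Pi.zero_apply]

theorem tendsto_torusFlowMean_mFourier (hθ : LinearIndependent ℤ θ) (n : ι → ℤ) :
    Tendsto (torusFlowMean θ · (UnitAddTorus.mFourier n)) atTop
      (𝓝 (∫ x, UnitAddTorus.mFourier n x)) := by
  have hfreq : 2 * Real.pi * ∑ i, n i • θ i = 0 ↔ n = 0 := by
    refine ⟨fun h => funext (Fintype.linearIndependent_iff.1 hθ n ?_), fun h => by simp [h]⟩
    simpa [Real.pi_ne_zero] using h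
  simpa only [torusFlowMean, mFourier_torusFlow, integral_mFourier, hfreq] using
    tendsto_mean_exp_mul_I (2 * Real.pi * ∑ i, n i • θ i)

theorem tendsto_torusFlowMean (hθ : LinearIndependent ℤ θ) (f : C(UnitAddTorus ι, ℂ)) :
    Tendsto (torusFlowMean θ · f) atTop (𝓝 (∫ x, f x)) := by
  have hint : Continuous fun f : C(UnitAddTorus ι, ℂ) => ∫ x, f x :=
    (continuous_integral.comp (ContinuousMap.toLp 1 volume ℂ).continuous).congr fun f =>
      integral_congr_ae (ContinuousMap.coeFn_toLp volume f)
  have hf : f ∈ (Submodule.span ℂ (Set.range UnitAddTorus.mFourier)).topologicalClosure := by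
    rw [UnitAddTorus.span_mFourier_closure_eq_top]; trivial
  refine closure_minimal (fun g hg => ?_)
    ((equicontinuous_torusFlowMean θ).isClosed_setOfPred_tendsto hint) hf
  have hintegrable (g : C(UnitAddTorus ι, ℂ)) : Integrable g :=
    g.continuous.integrable_of_hasCompactSupport (HasCompactSupport.of_compactSpace g)
  induction hg using Submodule.span_induction with
  | mem g hg =>
    obtain ⟨n, rfl⟩ := hg
    exact tendsto_torusFlowMean_mFourier hθ n
  | zero => simp [torusFlowMean]
  | add g h _ _ hg hh =>
    simpa only [Set.mem_ofPred_eq, torusFlowMean_add, ContinuousMap.add_apply,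
      integral_add (hintegrable g) (hintegrable h)] using hg.add hh
  | smul c g _ hg =>
    simpa only [Set.mem_ofPred_eq, torusFlowMean_smul, ContinuousMap.smul_apply,
      integral_smul] using hg.const_smul c

end Fintype

variable [Finite ι]

theorem denseRange_torusFlow (hθ : LinearIndependent ℤ θ) : DenseRange (torusFlow θ) := by
  cases nonempty_fintype ι
  intro x
  by_contra hx
  obtain ⟨f, hf0, hf1, hf⟩ := exists_continuous_zero_one_of_isClosed
    (isClosed_closure (s := Set.range (torusFlow θ))) (isClosed_singleton (x := x))
    (Set.disjoint_singleton_right.2 hx)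
  have hpos : 0 < ∫ y, f y :=
    f.continuous.integral_pos_of_hasCompactSupport_nonneg_nonzero
      (HasCompactSupport.of_compactSpace f) (fun y => (hf y).1)
      (by rw [hf1 rfl]; exact one_ne_zero : f x ≠ 0)
  let g : C(UnitAddTorus ι, ℂ) := ⟨fun y => f y, by fun_prop⟩
  have hmean (T : ℝ) : torusFlowMean θ T g = 0 := by
    have hflow (t : ℝ) : f (torusFlow θ t) = 0 := hf0 (subset_closure (Set.mem_range_self t))
    simp [torusFlowMean, g, hflow]
  have hlim : ∫ y, g y = 0 :=
    tendsto_nhds_unique (tendsto_torusFlowMean hθ g) (by simp [hmean])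
  have hcast : ∫ y, g y = (∫ y, f y : ℝ) := integral_ofReal
  exact hpos.ne' (by exact_mod_cast hcast ▸ hlim)

theorem exists_tendsto_exp_of_linearIndependent (hθ : LinearIndependent ℤ θ) (α : ι → ℝ) :
    ∃ t : ℕ → ℝ, ∀ i,
      Tendsto (fun k => Complex.exp (Complex.I * (t k * θ i : ℝ))) atTop
        (𝓝 (Complex.exp (Complex.I * α i))) := by
  have hexp (s : ℝ) :
      fourier 1 ((s / (2 * Real.pi) : ℝ) : UnitAddCircle) = Complex.exp (Complex.I * s) := by
    rw [fourier_coe_apply]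
    congr 1
    push_cast
    field_simp
  obtain ⟨u, hu, hlim⟩ := mem_closure_iff_seq_limit.1
    (denseRange_torusFlow hθ fun i => ((α i / (2 * Real.pi) : ℝ) : UnitAddCircle))
  choose s hs using hu
  refine ⟨fun k => 2 * Real.pi * s k, fun i => ?_⟩
  have htends := ((fourier 1).continuous.tendsto _).comp (tendsto_pi_nhds.1 hlim i)
  rw [hexp] at htends
  refine htends.congr fun k => ?_
  rw [Function.comp_apply, ← hs, torusFlow, ← hexp]
  congr 2
  field_simp

end Kronecker

section Cosines

open Real Polynomial

theorem eq_zero_of_aeval_primitiveRoot_eq_zero {K : Type*} [Field K] [CharZero K] {N : ℕ}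
    [NeZero N] {ζ : K} (hζ : IsPrimitiveRoot ζ N) {p : ℤ[X]} (hp : aeval ζ p = 0)
    (hdeg : p.natDegree < N.totient) : p = 0 := by
  have hN : 0 < N := Nat.pos_of_neZero N
  refine eq_zero_of_dvd_of_natDegree_lt (p := cyclotomic N ℤ) ?_ ?_
  · rw [cyclotomic_eq_minpoly hζ hN]
    exact minpoly.isIntegrallyClosed_dvd (hζ.isIntegral hN) hp
  · rwa [natDegree_cyclotomic]

/-- The palindromic polynomial `∑ r, l r * (X ^ (m + r) + X ^ (m - r))`, which turns an integral
relation between the sums `z ^ r + z ^ (-r)` into an algebraic equation for `z`. -/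
noncomputable def palindromicSum {m : ℕ} (l : Fin (m + 1) → ℤ) : ℤ[X] :=
  ∑ r, C (l r) * (X ^ (m + r : ℕ) + X ^ (m - r : ℕ))

theorem natDegree_palindromicSum_le {m : ℕ} (l : Fin (m + 1) → ℤ) :
    (palindromicSum l).natDegree ≤ 2 * m := by
  refine natDegree_sum_le_of_forall_le _ _ fun r _ => (natDegree_C_mul_le _ _).trans ?_
  refine natDegree_add_le_of_degree_le ?_ ?_ <;> rw [natDegree_X_pow] <;> omega

theorem coeff_palindromicSum {m : ℕ} (l : Fin (m + 1) → ℤ) (s : Fin (m + 1)) :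
    (palindromicSum l).coeff (m + s) = if (s : ℕ) = 0 then 2 * l s else l s := by
  simp only [palindromicSum, finsetSum_coeff, coeff_C_mul, coeff_add, coeff_X_pow]
  rw [Finset.sum_eq_single_of_mem s (Finset.mem_univ s) fun r _ hr => ?_]
  · split_ifs <;> omega
  · have hne : (r : ℕ) ≠ s := Fin.val_ne_of_ne hr
    rw [if_neg (by omega), if_neg (by omega), add_zero, mul_zero]

theorem aeval_palindromicSum {K : Type*} [Field K] {m : ℕ} (l : Fin (m + 1) → ℤ) {z : K}
    (hz : z ≠ 0) :
    aeval z (palindromicSum l) = z ^ m * ∑ r, l r * (z ^ (r : ℕ) + (z ^ (r : ℕ))⁻¹) := by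
  simp only [palindromicSum, map_sum, map_mul, map_add, map_pow, aeval_X,
    Finset.mul_sum, eq_intCast, map_intCast]
  refine Finset.sum_congr rfl fun r _ => ?_
  rw [pow_add, pow_sub₀ z hz (Nat.lt_succ_iff.1 r.2)]
  ring

theorem linearIndependent_two_mul_cos {m N : ℕ} (h : 2 * m < N.totient) :
    LinearIndependent ℤ fun r : Fin (m + 1) => 2 * cos (2 * π * r / N) := by
  have : NeZero N := ⟨by rintro rfl; simp at h⟩
  set ζ : ℂ := Complex.exp (2 * π * Complex.I / N) with hζ
  have hprim : IsPrimitiveRoot ζ N := Complex.isPrimitiveRoot_exp N (NeZero.ne N)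
  have hcos (r : ℕ) : ((2 * cos (2 * π * r / N) : ℝ) : ℂ) = ζ ^ r + (ζ ^ r)⁻¹ := by
    push_cast
    rw [Complex.two_cos, hζ, ← Complex.exp_nat_mul, ← Complex.exp_neg]
    congr 2 <;> ring
  refine Fintype.linearIndependent_iff.2 fun l hl s => ?_
  have hroot : aeval ζ (palindromicSum l) = 0 := by
    rw [aeval_palindromicSum l (hprim.ne_zero (NeZero.ne N))]
    simp only [← hcos, zsmul_eq_mul] at hl ⊢
    exact_mod_cast mul_eq_zero_of_right _ (congrArg ((↑) : ℝ → ℂ) hl)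
  have hzero : palindromicSum l = 0 :=
    eq_zero_of_aeval_primitiveRoot_eq_zero hprim hroot ((natDegree_palindromicSum_le l).trans_lt h)
  have hcoeff := coeff_palindromicSum l s
  rw [hzero, coeff_zero] at hcoeff
  split_ifs at hcoeff <;> omega

theorem exists_le_cos_eq_or_eq_neg (M : ℕ) [NeZero M] (n : ℕ) :
    ∃ r ≤ M, Even (r + n) ∧ (cos (2 * π * n / (4 * M : ℕ)) = cos (2 * π * r / (4 * M : ℕ)) ∨
      cos (2 * π * n / (4 * M : ℕ)) = -cos (2 * π * r / (4 * M : ℕ))) := by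
  have hM := NeZero.pos M
  set s := n % (2 * M)
  have hn : n = s + 2 * M * (n / (2 * M)) := (Nat.mod_add_div n (2 * M)).symm
  have hs2 : s < 2 * M := Nat.mod_lt _ (by omega)
  have hcos : cos (2 * π * n / (4 * M : ℕ)) =
      (-1) ^ (n / (2 * M)) * cos (2 * π * s / (4 * M : ℕ)) := by
    rw [← cos_add_nat_mul_pi]
    congr 1
    nth_rw 1 [hn]
    push_cast
    field_simp
    ring
  have heven : Even (s + n) := by
    rw [hn]; exact ⟨s + M * (n / (2 * M)), by ring⟩
  have hrefl : cos (2 * π * (2 * M - s : ℕ) / (4 * M : ℕ)) = -cos (2 * π * s / (4 * M : ℕ)) := by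
    rw [← cos_pi_sub]
    congr 1
    rw [Nat.cast_sub hs2.le]
    push_cast
    field_simp
    ring
  rcases le_total s M with hle | hle
  · refine ⟨s, hle, heven, ?_⟩
    rcases neg_one_pow_eq_or ℝ (n / (2 * M)) with h | h <;> rw [hcos, h] <;> simp
  · refine ⟨2 * M - s, by omega, by grind, ?_⟩
    rcases neg_one_pow_eq_or ℝ (n / (2 * M)) with h | h <;> rw [hcos, hrefl, h] <;> simp

theorem exp_I_mul_nat_mul_pi (n : ℕ) : Complex.exp (Complex.I * (n * π : ℝ)) = (-1) ^ n := by
  rw [← Complex.exp_pi_mul_I, ← Complex.exp_nat_mul]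
  push_cast
  ring_nf

theorem exists_tendsto_exp_two_mul_cos (j : ℕ) :
    ∃ t : ℕ → ℝ, ∀ r : ℕ, r ≤ 2 ^ j →
      Tendsto (fun i => Complex.exp
          (Complex.I * (t i * (2 * cos (2 * π * r / (4 * 2 ^ j : ℕ))) : ℝ)))
        atTop (𝓝 ((-1) ^ (2 ^ j + r))) := by
  have hpos : 0 < 2 ^ j := by positivity
  have htot : 2 * (2 ^ j - 1) < (4 * 2 ^ j).totient := by
    rw [show 4 * 2 ^ j = 2 ^ (j + 1 + 1) by ring, Nat.totient_prime_pow_succ Nat.prime_two]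
    omega
  obtain ⟨t, ht⟩ := exists_tendsto_exp_of_linearIndependent (linearIndependent_two_mul_cos htot)
    fun r => (2 ^ j + r : ℕ) * π
  refine ⟨t, fun r hr => ?_⟩
  rcases hr.lt_or_eq with hlt | rfl
  · simpa only [exp_I_mul_nat_mul_pi] using ht ⟨r, by omega⟩
  · have hangle : 2 * π * (2 ^ j : ℕ) / (4 * 2 ^ j : ℕ) = π / 2 := by
      push_cast
      field_simp
      norm_num
    simp_rw [hangle]
    simp [← two_mul, pow_mul]

theorem exists_re_eq_cos_and_pow_eq_neg_one_pow {M : ℕ} [NeZero M] {z : ℂ}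
    (hz : z ^ (4 * M) = 1) :
    ∃ n : ℕ, z.re = cos (2 * π * n / (4 * M : ℕ)) ∧ z ^ (2 * M) = (-1) ^ n := by
  obtain ⟨n, -, rfl⟩ :=
    (Complex.isPrimitiveRoot_exp (4 * M) (NeZero.ne _)).eq_pow_of_pow_eq_one hz
  have hM := NeZero.ne M
  refine ⟨n, ?_, ?_⟩
  · rw [← Complex.exp_nat_mul, ← Complex.exp_ofReal_mul_I_re]
    push_cast
    ring_nf
  · rw [pow_right_comm, ← Complex.exp_nat_mul _ (2 * M), ← Complex.exp_pi_mul_I]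
    congr 2
    push_cast
    field_simp
    norm_num

theorem exists_tendsto_exp_two_mul_re (j : ℕ) :
    ∃ (t : ℕ → ℝ) (η : ℂ), (η = 1 ∨ η = -1) ∧ ∀ z : ℂ, z ^ 2 ^ (j + 2) = 1 →
      Tendsto (fun i => Complex.exp (Complex.I * (t i * (2 * z.re) : ℝ))) atTop
        (𝓝 (η * z ^ 2 ^ (j + 1))) := by
  obtain ⟨t, ht⟩ := exists_tendsto_exp_two_mul_cos j
  refine ⟨t, (-1) ^ 2 ^ j, neg_one_pow_eq_or ℂ _, fun z hz => ?_⟩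
  rw [show 2 ^ (j + 2) = 4 * 2 ^ j by ring] at hz
  rw [pow_succ' 2 j]
  obtain ⟨n, hre, hpow⟩ := exists_re_eq_cos_and_pow_eq_neg_one_pow hz
  obtain ⟨r, hr, hparity, hcos⟩ := exists_le_cos_eq_or_eq_neg (2 ^ j) n
  rw [hre, hpow, ← neg_one_pow_congr (Nat.even_add.1 hparity), ← pow_add]
  rcases hcos with hcos | hcos <;> rw [hcos]
  · exact ht r hr
  · have hinv := (ht r hr).inv₀ (pow_ne_zero _ (neg_ne_zero.2 one_ne_zero))
    simp only [← Complex.exp_neg, ← inv_pow, inv_neg, inv_one] at hinv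
    refine hinv.congr fun i => congrArg _ ?_
    push_cast
    ring

end Cosines

section CycleGraph

open SimpleGraph

variable {N : ℕ} [NeZero N]

theorem cycleGraph_adj_iff_eq_add_one (hN : 2 ≤ N) {u v : Fin N} :
    (cycleGraph N).Adj u v ↔ v = u + 1 ∨ u = v + 1 := by
  obtain ⟨n, rfl⟩ := Nat.exists_eq_add_of_le' hN
  rw [cycleGraph_adj, or_comm, sub_eq_iff_eq_add', sub_eq_iff_eq_add']

theorem cycleGraph_connected_of_neZero : (cycleGraph N).Connected := by
  obtain ⟨n, rfl⟩ := Nat.exists_eq_succ_of_ne_zero (NeZero.ne N)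
  exact cycleGraph_connected

theorem addOrderOf_fin_one : addOrderOf (1 : Fin N) = N := by
  obtain ⟨n, rfl⟩ := Nat.exists_eq_succ_of_ne_zero (NeZero.ne N)
  exact ZMod.addOrderOf_one (n + 1)

theorem eq_val_nsmul_one (u : Fin N) : u = u.val • (1 : Fin N) := by
  obtain ⟨n, rfl⟩ := Nat.exists_eq_succ_of_ne_zero (NeZero.ne N)
  exact ((nsmul_one u.val).trans (ZMod.natCast_zmod_val (n := n + 1) u)).symm

theorem exists_eq_add_zsmul_one_of_walk (hN : 2 ≤ N) {u v : Fin N} (p : (cycleGraph N).Walk u v) :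
    ∃ z : ℤ, |z| ≤ p.length ∧ v = u + z • (1 : Fin N) := by
  induction p with
  | nil => exact ⟨0, by simp⟩
  | cons h p ih =>
    obtain ⟨z, hz, hv⟩ := ih
    rw [Walk.length_cons]
    rcases (cycleGraph_adj_iff_eq_add_one hN).1 h with rfl | rfl
    · exact ⟨z + 1, by grind, by rw [hv, add_zsmul, one_zsmul]; abel⟩
    · exact ⟨z - 1, by grind, by rw [hv, sub_zsmul, one_zsmul]; abel⟩

theorem cycleGraph_dist_add_nsmul_one_le (hN : 2 ≤ N) (u : Fin N) (n : ℕ) :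
    (cycleGraph N).dist u (u + n • 1) ≤ n := by
  induction n with
  | zero => simp
  | succ n ih =>
    have hadj : (cycleGraph N).Adj (u + n • 1) (u + (n + 1) • 1) :=
      (cycleGraph_adj_iff_eq_add_one hN).2 (.inl (by rw [succ_nsmul, add_assoc]))
    have := cycleGraph_connected_of_neZero.dist_triangle (u := u) (v := u + n • 1)
      (w := u + (n + 1) • 1)
    rw [dist_eq_one_iff_adj.2 hadj] at this
    omega

theorem le_cycleGraph_dist_add_nsmul_one {h : ℕ} [NeZero (2 * h)] (u : Fin (2 * h)) :
    h ≤ (cycleGraph (2 * h)).dist u (u + h • 1) := by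
  have hh : 2 ≤ 2 * h := by have := NeZero.ne (2 * h); omega
  obtain ⟨p, hp⟩ := cycleGraph_connected_of_neZero.exists_walk_length_eq_dist u (u + h • 1)
  obtain ⟨z, hz, hv⟩ := exists_eq_add_zsmul_one_of_walk hh p
  have hdvd : ((2 * h : ℕ) : ℤ) ∣ h - z := by
    rw [← addOrderOf_fin_one (N := 2 * h), addOrderOf_dvd_iff_zsmul_eq_zero, sub_zsmul,
      natCast_zsmul, add_left_cancel hv, add_neg_cancel]
  by_contra! hlt
  have := Int.le_of_dvd (by grind) hdvd
  grind

theorem IsAntipodal.symm {V : Type*} {G : SimpleGraph V} {u v : V} (h : IsAntipodal G u v) :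
    IsAntipodal G v u :=
  SimpleGraph.dist_comm.trans h

theorem IsAntipodal.eq_add_nsmul_one {h : ℕ} (hN : N = 2 * h) {a c : Fin N}
    (hac : IsAntipodal (cycleGraph N) a c) : c = a + h • 1 := by
  subst hN
  have hh : 2 ≤ 2 * h := by have := NeZero.ne (2 * h); omega
  have hdiam : h ≤ (cycleGraph (2 * h)).dist a c :=
    ((le_cycleGraph_dist_add_nsmul_one a).trans
      (dist_le_diam (connected_iff_ediam_ne_top.1 cycleGraph_connected_of_neZero))).trans_eq
        (Eq.symm hac)
  obtain ⟨n, hn, hc⟩ : ∃ n < 2 * h, c = a + n • 1 := by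
    refine ⟨(c - a).val, (c - a).isLt, ?_⟩
    rw [← eq_val_nsmul_one, add_sub_cancel]
  have hle : h ≤ n := hdiam.trans (hc ▸ cycleGraph_dist_add_nsmul_one_le hh a n)
  have hge : h ≤ 2 * h - n := by
    have ha : a = c + (2 * h - n) • 1 := by
      rw [hc, add_assoc, ← add_nsmul, Nat.add_sub_cancel' hn.le]
      rw [addOrderOf_dvd_iff_nsmul_eq_zero.1 addOrderOf_fin_one.dvd, add_zero]
    rw [SimpleGraph.dist_comm] at hdiam
    exact hdiam.trans (ha ▸ cycleGraph_dist_add_nsmul_one_le hh c (2 * h - n))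
  rw [hc]
  congr 1; congr 1; omega

theorem cycleGraph_isRegularOfDegree_two (hN : 3 ≤ N) : (cycleGraph N).IsRegularOfDegree 2 := by
  obtain ⟨n, rfl⟩ := Nat.exists_eq_add_of_le' hN
  exact fun _ => cycleGraph_degree_three_le

theorem cycleGraph_adjMatrix_mulVec_addChar (hN : 3 ≤ N) (ψ : AddChar (Fin N) ℂ) :
    (cycleGraph N).adjMatrix ℂ *ᵥ ψ = (2 * (ψ 1).re : ℂ) • ⇑ψ := by
  ext u
  have hne : u - 1 ≠ u + 1 := by
    obtain ⟨n, rfl⟩ := Nat.exists_eq_add_of_le' hN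
    have hdeg := cycleGraph_isRegularOfDegree_two hN u
    rw [cycleGraph_degree_two_le] at hdeg
    exact fun h => by simp [h] at hdeg
  have hnbr : (cycleGraph N).neighborFinset u = {u - 1, u + 1} := by
    obtain ⟨n, rfl⟩ := Nat.exists_eq_add_of_le' (by omega : 2 ≤ N)
    exact cycleGraph_neighborFinset
  rw [adjMatrix_mulVec_apply, hnbr, Finset.sum_pair hne, sub_eq_add_neg,
    ψ.map_add_eq_mul, ψ.map_add_eq_mul, ψ.map_neg_eq_conj, ← mul_add, add_comm, Complex.add_conj,
    mul_comm, Pi.smul_apply, smul_eq_mul, Complex.ofReal_mul, Complex.ofReal_ofNat]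

end CycleGraph

section Fourier

theorem exists_eq_sum_addChar {A : Type*} [AddCommGroup A] [Finite A] (f : A → ℂ) :
    ∃ c : AddChar A ℂ → ℂ, f = ∑ ψ, c ψ • ⇑ψ := by
  refine ⟨(AddChar.complexBasis A).repr f, ?_⟩
  conv_lhs => rw [← (AddChar.complexBasis A).sum_repr f]
  simp only [AddChar.complexBasis_apply]

open scoped Classical in
theorem exists_eq_sum_ne_zero_addChar {A : Type*} [AddCommGroup A] [Fintype A] {f : A → ℂ}
    (hf : ∑ s, f s = 0) :
    ∃ c : AddChar A ℂ → ℂ, f = ∑ ψ with ψ ≠ 0, c ψ • ⇑ψ := by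
  obtain ⟨c, rfl⟩ := exists_eq_sum_addChar f
  have hc : c 0 = 0 := by
    simpa [Finset.sum_apply, Finset.sum_comm (γ := A), ← Finset.mul_sum,
      AddChar.sum_eq_ite] using hf
  refine ⟨c, (Finset.sum_filter_of_ne fun ψ _ hψ => ?_).symm⟩
  rintro rfl
  exact hψ (by rw [hc, zero_smul])

end Fourier

section Hamiltonian

open SimpleGraph

theorem map_ofReal_adjMatrix {V : Type*} (H : SimpleGraph V) [DecidableRel H.Adj] :
    (H.adjMatrix ℝ).map Complex.ofReal = H.adjMatrix ℂ := by
  ext u v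
  simp [adjMatrix_apply, apply_ite]

variable {V : Type*} [Fintype V] [DecidableEq V]

theorem map_ofReal_degMatrix (H : SimpleGraph V) [DecidableRel H.Adj] :
    (H.degMatrix ℝ).map Complex.ofReal = H.degMatrix ℂ := by
  simp [degMatrix, Matrix.diagonal_map]

theorem map_ofReal_hamiltonian_adjacency (H : SimpleGraph V) [DecidableRel H.Adj] :
    (hamiltonian .adjacency H).map Complex.ofReal = H.adjMatrix ℂ := by
  rw [← map_ofReal_adjMatrix, hamiltonian]
  congr!

theorem map_ofReal_hamiltonian_laplacian (H : SimpleGraph V) [DecidableRel H.Adj] :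
    (hamiltonian .laplacian H).map Complex.ofReal = H.degMatrix ℂ - H.adjMatrix ℂ := by
  rw [← map_ofReal_adjMatrix, ← map_ofReal_degMatrix, ← Matrix.map_sub _ Complex.ofReal_sub,
    hamiltonian]
  congr!

theorem map_ofReal_hamiltonian_signlessLaplacian (H : SimpleGraph V) [DecidableRel H.Adj] :
    (hamiltonian .signlessLaplacian H).map Complex.ofReal = H.degMatrix ℂ + H.adjMatrix ℂ := by
  rw [← map_ofReal_adjMatrix, ← map_ofReal_degMatrix, ← Matrix.map_add _ Complex.ofReal_add,
    hamiltonian]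
  congr!

end Hamiltonian

section Complement

open SimpleGraph

variable {V W : Type*} [Fintype V] [Fintype W] {G : SimpleGraph V} [DecidableRel G.Adj]
  (φ : V ↪ W)

theorem sum_extend_zero {M : Type*} [AddCommMonoid M] (f : V → M) :
    ∑ w, Function.extend φ f (0 : W → M) w = ∑ v, f v :=
  (Fintype.sum_of_injective φ φ.injective f _
    (fun w hw => Function.extend_apply' f (0 : W → M) w (by simpa using hw))
    fun _ => (φ.injective.extend_apply _ _ _).symm).symm

theorem neighborFinset_map_embedding [DecidableRel (G.map φ).Adj] (v : V) :
    (G.map φ).neighborFinset (φ v) = (G.neighborFinset v).map φ := by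
  rw [← Finset.coe_inj]
  simp [neighborSet_map]

theorem degree_map_embedding [DecidableRel (G.map φ).Adj] (v : V) :
    (G.map φ).degree (φ v) = G.degree v := by
  rw [degree, neighborFinset_map_embedding, Finset.card_map, card_neighborFinset_eq_degree]

theorem adjMatrix_map_mulVec_extend [DecidableRel (G.map φ).Adj] (f : V → ℂ) :
    (G.map φ).adjMatrix ℂ *ᵥ Function.extend φ f 0 =
      Function.extend φ (G.adjMatrix ℂ *ᵥ f) 0 := by
  ext w
  rw [adjMatrix_mulVec_apply]
  by_cases hw : w ∈ Set.range φ
  · obtain ⟨v, rfl⟩ := hw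
    simp only [neighborFinset_map_embedding, Finset.sum_map, φ.injective.extend_apply,
      adjMatrix_mulVec_apply]
  · rw [Function.extend_apply' _ _ _ (by simpa using hw)]
    refine Finset.sum_eq_zero fun u hu => ?_
    obtain ⟨-, v, v', -, hv, -⟩ := (mem_neighborFinset ..).1 hu
    exact absurd ⟨v, hv⟩ hw

variable [DecidableEq W]

theorem compl_adjMatrix_mulVec_of_sum_eq_zero {H : SimpleGraph W} [DecidableRel H.Adj] {x : W → ℂ}
    (hx : ∑ w, x w = 0) : Hᶜ.adjMatrix ℂ *ᵥ x = -x - H.adjMatrix ℂ *ᵥ x := by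
  have hadj : Hᶜ.adjMatrix ℂ = Matrix.of 1 - 1 - H.adjMatrix ℂ := by
    rw [← adjMatrix_completeGraph_eq_of_one_sub_one,
      ← isCompl_compl.adjMatrix_add_adjMatrix_eq_adjMatrix_completeGraph ℂ (G := H),
      add_sub_cancel_left]
  have hone : (Matrix.of 1 : Matrix W W ℂ) *ᵥ x = 0 := by
    ext w
    simp [Matrix.mulVec, dotProduct, hx]
  rw [hadj, Matrix.sub_mulVec, Matrix.sub_mulVec, hone, Matrix.one_mulVec, zero_sub]

theorem compl_map_degMatrix_mulVec_extend [DecidableRel (G.map φ).Adj] {d : ℕ}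
    (hG : G.IsRegularOfDegree d) (f : V → ℂ) :
    (G.map φ)ᶜ.degMatrix ℂ *ᵥ Function.extend φ f 0 =
      ((Fintype.card W : ℂ) - 1 - d) • Function.extend φ f 0 := by
  ext w
  rw [degMatrix_mulVec_apply, Pi.smul_apply, smul_eq_mul]
  by_cases hw : w ∈ Set.range φ
  · obtain ⟨v, rfl⟩ := hw
    have hdeg : (G.map φ).degree (φ v) = d := by rw [degree_map_embedding, hG.degree_eq]
    have hlt := (G.map φ).degree_lt_card_verts (φ v)
    rw [degree_compl, hdeg, Nat.cast_sub (by omega), Nat.cast_sub (by omega), Nat.cast_one]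
  · rw [Function.extend_apply' _ _ _ (by simpa using hw), Pi.zero_apply, mul_zero, mul_zero]

theorem exists_hamiltonian_compl_map_mulVec_extend {d : ℕ} (hG : G.IsRegularOfDegree d)
    (m : HamiltonianType) :
    ∃ α σ : ℝ, (σ = 1 ∨ σ = -1) ∧ ∀ f : V → ℂ, ∑ v, f v = 0 →
      (hamiltonian m (G.map φ)ᶜ).map Complex.ofReal *ᵥ Function.extend φ f 0 =
        (α : ℂ) • Function.extend φ f 0 +
          (σ : ℂ) • Function.extend φ (G.adjMatrix ℂ *ᵥ f) 0 := by
  classical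
  have hA (f : V → ℂ) (hf : ∑ v, f v = 0) :
      (G.map φ)ᶜ.adjMatrix ℂ *ᵥ Function.extend φ f 0 =
        -Function.extend φ f 0 - Function.extend φ (G.adjMatrix ℂ *ᵥ f) 0 := by
    rw [compl_adjMatrix_mulVec_of_sum_eq_zero (by rwa [sum_extend_zero]),
      adjMatrix_map_mulVec_extend]
  cases m with
  | adjacency =>
    refine ⟨-1, -1, .inr rfl, fun f hf => ?_⟩
    rw [map_ofReal_hamiltonian_adjacency, hA f hf]
    push_cast; module
  | laplacian =>
    refine ⟨Fintype.card W - d, 1, .inl rfl, fun f hf => ?_⟩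
    rw [map_ofReal_hamiltonian_laplacian, Matrix.sub_mulVec, hA f hf,
      compl_map_degMatrix_mulVec_extend φ hG]
    push_cast; module
  | signlessLaplacian =>
    refine ⟨Fintype.card W - 2 - d, -1, .inr rfl, fun f hf => ?_⟩
    rw [map_ofReal_hamiltonian_signlessLaplacian, Matrix.add_mulVec, hA f hf,
      compl_map_degMatrix_mulVec_extend φ hG]
    push_cast; module

theorem completeMinusCycle_eq_compl_map {N n : ℕ}
    (φ : Copy (cycleGraph N) (⊤ : SimpleGraph (Fin n))) :
    completeMinusCycle φ = ((cycleGraph N).map φ.toEmbedding)ᶜ := by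
  ext u v
  simp only [completeMinusCycle, deleteEdges_adj, top_adj, Subgraph.mem_edgeSet, Subgraph.map_adj,
    Relation.Map, Subgraph.top_adj, compl_adj, map_adj]
  rfl

end Complement

section Evolution

open scoped Matrix.Norms.Operator in
theorem exp_smul_mulVec_of_mulVec_eq {V : Type*} [Fintype V] [DecidableEq V]
    {A : Matrix V V ℂ} {x : V → ℂ} {μ : ℂ} (h : A *ᵥ x = μ • x) (z : ℂ) :
    NormedSpace.exp (z • A) *ᵥ x = Complex.exp (z * μ) • x := by
  have hpow (n : ℕ) : (z • A) ^ n *ᵥ x = (z * μ) ^ n • x := by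
    induction n with
    | zero => simp
    | succ n ih =>
      rw [pow_succ, ← Matrix.mulVec_mulVec, Matrix.smul_mulVec, h, smul_smul, Matrix.mulVec_smul,
        ih, smul_smul, pow_succ']
  have hmat := (NormedSpace.exp_series_hasSum_exp' (𝕂 := ℂ) (z • A)).map
    (Matrix.mulVecBilin ℂ ℂ |>.flip x) (by
      change Continuous fun B : Matrix V V ℂ => B *ᵥ x
      fun_prop)
  have hscal := (NormedSpace.exp_series_hasSum_exp' (𝕂 := ℂ) (z * μ)).smul_const x
  rw [← Complex.exp_eq_exp_ℂ] at hscal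
  exact hmat.unique (hscal.congr_fun fun n =>
    (Matrix.smul_mulVec _ _ _).trans (by rw [hpow, smul_assoc]))

theorem tendsto_transitionMatrix_mulVec {V : Type*} [Fintype V] [DecidableEq V]
    {M : Matrix V V ℝ} {x : V → ℂ} {μ : ℝ} (hx : M.map Complex.ofReal *ᵥ x = (μ : ℂ) • x)
    {t : ℕ → ℝ} {γ : ℂ}
    (ht : Tendsto (fun i => Complex.exp (Complex.I * (t i * μ : ℝ))) atTop (𝓝 γ)) :
    Tendsto (fun i => transitionMatrix M (t i) *ᵥ x) atTop (𝓝 (γ • x)) := by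
  refine (ht.smul_const x).congr fun i => ?_
  rw [transitionMatrix, exp_smul_mulVec_of_mulVec_eq hx, Complex.ofReal_mul, mul_assoc]

end Evolution

section Transfer

open SimpleGraph

theorem isRealPureState_pairState {V : Type*} [Fintype V] [DecidableEq V] {a b : V} (h : a ≠ b) :
    IsRealPureState (pairState a b) := by
  have hsq (v : V) :
      pairState a b v ^ 2 = (Pi.single a (1 / 2) + Pi.single b (1 / 2) : V → ℝ) v := by
    have hsqrt : (√2)⁻¹ ^ 2 = (1 / 2 : ℝ) := by
      rw [inv_pow, Real.sq_sqrt zero_le_two, one_div]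
    rcases eq_or_ne v a with rfl | ha
    · simp [pairState, h, hsqrt]
    · rcases eq_or_ne v b with rfl | hb
      · simp [pairState, ha, hsqrt]
      · simp [pairState, ha, hb]
  simp only [IsRealPureState, hsq, Pi.add_apply, Finset.sum_add_distrib, Fintype.sum_pi_single']
  norm_num

theorem sum_pairState {V : Type*} [Fintype V] [DecidableEq V] (a b : V) :
    ∑ v, pairState a b v = 0 := by
  simp [pairState, ← Finset.mul_sum]

theorem pairState_add_right {A : Type*} [AddGroup A] [DecidableEq A] (a b s u : A) :
    pairState (a + u) (b + u) (s + u) = pairState a b s := by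
  simp [pairState, Pi.single_apply]

theorem ofReal_pairState_apply_embedding {V W : Type*} [DecidableEq V] [DecidableEq W]
    (φ : V ↪ W) (a b : V) :
    (fun w => (pairState (φ a) (φ b) w : ℂ)) =
      Function.extend φ (fun v => (pairState a b v : ℂ)) 0 := by
  ext w
  by_cases hw : w ∈ Set.range φ
  · obtain ⟨v, rfl⟩ := hw
    simp [pairState, Pi.single_apply, φ.injective.extend_apply]
  · rw [Function.extend_apply' _ _ _ (by simpa using hw)]
    have hne (v : V) : w ≠ φ v := fun h => hw ⟨v, h.symm⟩
    simp [pairState, hne]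

theorem exists_tendsto_exp_affine (j : ℕ) (α : ℝ) {σ : ℝ} (hσ : σ = 1 ∨ σ = -1) :
    ∃ (t : ℕ → ℝ) (γ : ℂ), ‖γ‖ = 1 ∧ ∀ z : ℂ, z ^ 2 ^ (j + 2) = 1 →
      Tendsto (fun i => Complex.exp (Complex.I * (t i * (α + σ * (2 * z.re)) : ℝ))) atTop
        (𝓝 (γ * z ^ 2 ^ (j + 1))) := by
  obtain ⟨t, η, hη, ht⟩ := exists_tendsto_exp_two_mul_re j
  obtain ⟨g, hg, u, hu, hlim⟩ := (isCompact_sphere (0 : ℂ) 1).tendsto_subseq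
    (x := fun i => Complex.exp (Complex.I * (t i * α : ℝ)))
    fun i => by rw [mem_sphere_zero_iff_norm, Complex.norm_exp_I_mul_ofReal]
  refine ⟨t ∘ u, g * η, ?_, fun z hz => ?_⟩
  · rw [norm_mul, mem_sphere_zero_iff_norm.1 hg]
    rcases hη with rfl | rfl <;> simp
  have hσz : Tendsto (fun i => Complex.exp (Complex.I * (t (u i) * (σ * (2 * z.re)) : ℝ))) atTop
      (𝓝 (η * z ^ 2 ^ (j + 1))) := by
    rcases hσ with rfl | rfl
    · simpa only [one_mul, Function.comp_def] using (ht z hz).comp hu.tendsto_atTop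
    · -- `-2 Re z = 2 Re (-z)`, and `-z` has the same even powers as `z`
      have hneg := (ht (-z) (by rwa [Even.neg_pow (by simp [parity_simps])])).comp
        hu.tendsto_atTop
      rw [Even.neg_pow (by simp [parity_simps])] at hneg
      simpa [Function.comp_def] using hneg
  rw [mul_assoc]
  refine (hlim.mul hσz).congr fun i => ?_
  rw [Function.comp_apply, Function.comp_apply, ← Complex.exp_add]
  push_cast; ring_nf

theorem extend_sum_smul {V W ι : Type*} (φ : V → W) (s : Finset ι) (c : ι → ℂ) (f : ι → V → ℂ) :
    Function.extend φ (∑ r ∈ s, c r • f r) 0 = ∑ r ∈ s, c r • Function.extend φ (f r) 0 :=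
  (map_sum (Function.ExtendByZero.linearMap ℂ φ) (fun r => c r • f r) s).trans
    (Finset.sum_congr rfl fun _ _ => map_smul (Function.ExtendByZero.linearMap ℂ φ) _ _)

theorem exists_hamiltonian_compl_map_cycleGraph_mulVec_addChar {W : Type*} [Fintype W]
    [DecidableEq W] {N : ℕ} [NeZero N] (hN : 3 ≤ N) (φ : Fin N ↪ W) (m : HamiltonianType) :
    ∃ α σ : ℝ, (σ = 1 ∨ σ = -1) ∧ ∀ ψ : AddChar (Fin N) ℂ, ψ ≠ 0 →
      (hamiltonian m ((cycleGraph N).map φ)ᶜ).map Complex.ofReal *ᵥ Function.extend φ ψ 0 =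
        ((α + σ * (2 * (ψ 1).re) : ℝ) : ℂ) • Function.extend φ ψ 0 := by
  obtain ⟨α, σ, hσ, hM⟩ :=
    exists_hamiltonian_compl_map_mulVec_extend φ (cycleGraph_isRegularOfDegree_two hN) m
  refine ⟨α, σ, hσ, fun ψ hψ => ?_⟩
  have hsmul (z : ℂ) : Function.extend φ (z • ⇑ψ) 0 = z • Function.extend φ ψ 0 :=
    map_smul (Function.ExtendByZero.linearMap ℂ φ) z _
  rw [hM ψ (AddChar.sum_eq_zero_iff_ne_zero.2 hψ), cycleGraph_adjMatrix_mulVec_addChar hN, hsmul]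
  push_cast; module

theorem exists_tendsto_transitionMatrix_extend {W : Type*} [Fintype W] [DecidableEq W] (j : ℕ)
    (φ : Fin (2 ^ (j + 2)) ↪ W) (m : HamiltonianType) :
    ∃ (t : ℕ → ℝ) (γ : ℂ), ‖γ‖ = 1 ∧ ∀ f : Fin (2 ^ (j + 2)) → ℂ, ∑ s, f s = 0 →
      Tendsto
        (fun i => transitionMatrix (hamiltonian m ((cycleGraph (2 ^ (j + 2))).map φ)ᶜ) (t i) *ᵥ
          Function.extend φ f 0) atTop
        (𝓝 (γ • Function.extend φ (fun s => f (s + 2 ^ (j + 1) • 1)) 0)) := by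
  classical
  have hN : 3 ≤ 2 ^ (j + 2) := by
    have := Nat.pow_le_pow_right two_pos (Nat.le_add_left 2 j)
    omega
  obtain ⟨α, σ, hσ, hM⟩ := exists_hamiltonian_compl_map_cycleGraph_mulVec_addChar hN φ m
  obtain ⟨t, γ, hγ, ht⟩ := exists_tendsto_exp_affine j α hσ
  refine ⟨t, γ, hγ, fun f hf => ?_⟩
  obtain ⟨c, rfl⟩ := exists_eq_sum_ne_zero_addChar hf
  have htranslate : (fun s => (∑ ψ with ψ ≠ 0, c ψ • ⇑ψ) (s + 2 ^ (j + 1) • 1)) =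
      ∑ ψ : AddChar (Fin (2 ^ (j + 2))) ℂ with ψ ≠ 0, (c ψ * ψ 1 ^ 2 ^ (j + 1)) • ⇑ψ := by
    ext s
    simp only [Finset.sum_apply, Pi.smul_apply, smul_eq_mul, AddChar.map_add_eq_mul,
      AddChar.map_nsmul_eq_pow]
    exact Finset.sum_congr rfl fun ψ _ => by ring
  rw [htranslate, extend_sum_smul, extend_sum_smul, Finset.smul_sum]
  simp only [Matrix.mulVec_sum, Matrix.mulVec_smul]
  refine tendsto_finsetSum _ fun ψ hψ => ?_
  have hroot : ψ 1 ^ 2 ^ (j + 2) = 1 := by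
    rw [← ψ.map_nsmul_eq_pow, addOrderOf_dvd_iff_nsmul_eq_zero.1 addOrderOf_fin_one.dvd,
      ψ.map_zero_eq_one]
  convert (tendsto_transitionMatrix_mulVec (hM ψ (Finset.mem_filter.1 hψ).2)
    (ht _ hroot)).const_smul (c ψ) using 2
  module

end Transfer

theorem theorem5p3 (k n : ℕ) (hk : 2 ≤ k) (hn : 2 ^ k ≤ n)
    (φ : SimpleGraph.Copy (SimpleGraph.cycleGraph (2 ^ k)) (⊤ : SimpleGraph (Fin n)))
    (a b c d : Fin (2 ^ k)) (hab : a ≠ b)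
    (hac : IsAntipodal (SimpleGraph.cycleGraph (2 ^ k)) a c)
    (hbd : IsAntipodal (SimpleGraph.cycleGraph (2 ^ k)) b d)
    (m : HamiltonianType) :
    PrettyGoodStateTransfer (hamiltonian m (completeMinusCycle φ))
      (pairState (φ a) (φ b)) (pairState (φ c) (φ d)) := by
  obtain ⟨j, rfl⟩ := Nat.exists_eq_add_of_le' hk
  have ha : a = c + 2 ^ (j + 1) • 1 := hac.symm.eq_add_nsmul_one (pow_succ' 2 (j + 1))
  have hb : b = d + 2 ^ (j + 1) • 1 := hbd.symm.eq_add_nsmul_one (pow_succ' 2 (j + 1))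
  have hcd : c ≠ d := fun h => hab (by rw [ha, hb, h])
  have hshift (s) : pairState a b (s + 2 ^ (j + 1) • 1) = pairState c d s := by
    rw [ha, hb, pairState_add_right]
  obtain ⟨t, γ, hγ, ht⟩ := exists_tendsto_transitionMatrix_extend j φ.toEmbedding m
  have hlim := ht (fun s => pairState a b s) (mod_cast sum_pairState a b)
  simp only [hshift, ← completeMinusCycle_eq_compl_map, ← ofReal_pairState_apply_embedding] at hlim
  exact ⟨isRealPureState_pairState (φ.injective.ne hab),
    isRealPureState_pairState (φ.injective.ne hcd), t, γ, hγ, hlim⟩
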